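/- Let $n\ge 1$ and $m\ge 0$ be integers. Let $V=\{(i,j): 0\le i\le n,\ 0\le j\le b_i\}$, where either $b_i=i+m$ for all $i$ (trapezoidal configuration of size $(n,m)$, triangular if $m=0$), or $m\ge 1$ and $b_i=m$ for all $i$ (parallelogram-wise configuration of size $(n,m)$). For an array $X=(x_{ij})\in\mathbb{R}^V$ put $\partial x_{ij}:=x_{ij}-x_{i,j-1}$ ($0\le i\le n$, $1\le j\le b_i$). Call $X$ strip-concave if for all $1\le i\le n$ and $1\le j\le b_i$ one has $\partial x_{ij}\ge\partial x_{i-1,j}$ whenever $j\le b_{i-1}$, and $\partial x_{i-1,j}\ge\partial x_{i,j+1}$ whenever $j<b_i$. For real tuples $\lambda=(\lambda_1,\dots,\lambda_{b_n})$, $\bar\lambda=(\bar\lambda_1,\dots,\bar\lambda_{b_0})$, $\mu,\nu\in\mathbb{R}^n$, let $\mathcal{SC}(\lambda\setminus\bar\lambda,\mu,\nu)\subset\mathbb{R}^V$ be the polytope of all strip-concave arrays $X$ with $x_{00}=0$, $\partial x_{nj}=\lambda_j$ ($1\le j\le b_n$), $\partial x_{0j}=\bar\lambda_j$ ($1\le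 j\le b_0$), $x_{i0}-x_{i-1,0}=\mu_i$ and $x_{i,b_i}-x_{i-1,b_{i-1}}=\nu_i$ ($1\le i\le n$). Let $V_0\subseteq V$ be the set of boundary pairs, i.e. those $(i,j)\in V$ with $i=0$, $i=n$, $j=0$ or $j=b_i$. Then for all real $\lambda$, $\bar\lambda$, $\nu$ as above and every permutation $\nu'$ of (the entries of) $\nu$, the polytopes $\mathcal{SC}(\lambda\setminus\bar\lambda,0^n,\nu)$ and $\mathcal{SC}(\lambda\setminus\bar\lambda,0^n,\nu')$, where $0^n$ is the zero $n$-tuple, have the same $|V\setminus V_0|$-dimensional volume (Euclidean volume in the $|V\setminus V_0|$-dimensional affine subspaces of $\mathbb{R}^V$ obtained by fixing the entries on $V_0$). -/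

import Mathlib

open scoped MeasureTheory

/-- The index pairs `ij` of an array with rows `0, …, n`, where row `i` has the
entries `j = 0, …, b i` (the left bounds `a_i` are all zero). -/
abbrev ArrayIndex (n : ℕ) (b : ℕ → ℕ) : Type :=
  (i : Fin (n + 1)) × Fin (b i + 1)

/-- Trapezoidal configuration of size `(n, m)`: `b_i = i + m`
(triangular configuration when `m = 0`). -/
def IsTrapezoid (n m : ℕ) (b : ℕ → ℕ) : Prop :=
  ∀ i ≤ n, b i = i + m

/-- Parallelogram-wise configuration of size `(n, m)`, `m ≥ 1`: `b_i = m`. -/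
def IsParallelogram (n m : ℕ) (b : ℕ → ℕ) : Prop :=
  0 < m ∧ ∀ i ≤ n, b i = m

/-- The boundary index pairs (the set `V_0`): the pairs in the top and bottom rows and the
first and last pairs of every row. -/
def IsBoundaryIndex {n : ℕ} {b : ℕ → ℕ} (p : ArrayIndex n b) : Prop :=
  (p.1 : ℕ) = 0 ∨ (p.1 : ℕ) = n ∨ (p.2 : ℕ) = 0 ∨ (p.2 : ℕ) = b p.1

/-- The Euclidean space `ℝ^V` of all arrays with index set `V`. -/
abbrev ArraySpace (n : ℕ) (b : ℕ → ℕ) : Type :=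
  EuclideanSpace ℝ (ArrayIndex n b)

namespace ArraySpace

variable {n : ℕ} {b : ℕ → ℕ}

/-- The entry `x_{ij}`. (The value `0` outside the index set is never used below.) -/
noncomputable def entry (X : ArraySpace n b) (i j : ℕ) : ℝ :=
  if h : i < n + 1 ∧ j < b i + 1 then X ⟨⟨i, h.1⟩, ⟨j, h.2⟩⟩ else 0

/-- The row derivative `∂x_{ij} = x_{ij} - x_{i,j-1}` (used for `j ≥ 1` only). -/
noncomputable def rowDeriv (X : ArraySpace n b) (i j : ℕ) : ℝ :=
  X.entry i j - X.entry i (j - 1)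

/-- Strip-concavity: for `i = 1, …, n` and `j = 1, …, b_i`,
`∂x_{ij} ≥ ∂x_{i-1,j}` (when `j ≤ b_{i-1}`) and `∂x_{i-1,j} ≥ ∂x_{i,j+1}` (when `j < b_i`). -/
def IsStripConcave (X : ArraySpace n b) : Prop :=
  ∀ i j : ℕ, 1 ≤ i → i ≤ n → 1 ≤ j → j ≤ b i →
    (j ≤ b (i - 1) → X.rowDeriv (i - 1) j ≤ X.rowDeriv i j) ∧
    (j < b i → X.rowDeriv i (j + 1) ≤ X.rowDeriv (i - 1) j)

/-- The tuple of differences on the lower boundary, `λ_j = ∂x_{nj}`, `j = 1, …, b_n`. -/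
noncomputable def lower (X : ArraySpace n b) : Fin (b n) → ℝ :=
  fun k => X.rowDeriv n (k + 1)

/-- The tuple of differences on the upper boundary, `λ̄_j = ∂x_{0j}`, `j = 1, …, b_0`. -/
noncomputable def upper (X : ArraySpace n b) : Fin (b 0) → ℝ :=
  fun k => X.rowDeriv 0 (k + 1)

/-- The tuple of differences on the left boundary, `μ_i = x_{i0} - x_{i-1,0}`, `i = 1, …, n`. -/
noncomputable def left (X : ArraySpace n b) : Fin n → ℝ :=
  fun k => X.entry (k + 1) 0 - X.entry k 0

/-- The tuple of differences on the right boundary,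
`ν_i = x_{i,b_i} - x_{i-1,b_{i-1}}`, `i = 1, …, n`. -/
noncomputable def right (X : ArraySpace n b) : Fin n → ℝ :=
  fun k => X.entry (k + 1) (b (k + 1)) - X.entry k (b k)

end ArraySpace

/-- The polytope `SC(λ ∖ λ̄, μ, ν)` in `ℝ^V`: the strip-concave arrays with `x_{00} = 0` whose
lower, upper, left and right tuples of boundary differences are `λ`, `λ̄`, `μ` and `ν`. -/
def stripConcavePolytope {n : ℕ} {b : ℕ → ℕ} (lam : Fin (b n) → ℝ) (lamBar : Fin (b 0) → ℝ)
    (mu nu : Fin n → ℝ) : Set (ArraySpace n b) :=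
  {X | X.IsStripConcave ∧ X.entry 0 0 = 0 ∧
    X.lower = lam ∧ X.upper = lamBar ∧ X.left = mu ∧ X.right = nu}

/-- The number `|V ∖ V_0|` of interior index pairs. -/
noncomputable def interiorCard (n : ℕ) (b : ℕ → ℕ) : ℕ :=
  Nat.card {p : ArrayIndex n b // ¬ IsBoundaryIndex p}

/-! Adjacent transpositions generate the symmetric group, so it suffices to exchange two
neighbouring entries of ν. Fix every row except row `k + 1`. Strip-concavity then confines each
difference of that row, independently of the others, to an interval whose endpoints come from rows
`k` and `k + 2` (`interlaces_iff`). Reflecting every difference in the midpoint of its interval (a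
Bender–Knuth involution) preserves strip-concavity. Since max + min is the sum, the endpoints of all
these intervals add up to the totals of the two neighbouring rows
(`sum_diffLowerBound_add_diffUpperBound`). As the left column is zero, the last entry of the row
becomes the sum of the last entries of its neighbours minus itself, which exchanges the two entries
of ν. On entries the map is a negation plus a shift determined by other rows, hence volume
preserving (`measurePreserving_coordReflection`, `euclideanHausdorffMeasure_le_of_coordReflection`).
-/

/-! ### Coordinate reflections and volume in coordinate slices -/

open MeasureTheory in
/-- Reflecting the coordinates satisfying `p` about a centre that depends measurably on the
remaining coordinates preserves Lebesgue measure. -/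
theorem measurePreserving_coordReflection {ι : Type*} [Fintype ι] (p : ι → Prop)
    [DecidablePred p] (g : (ι → ℝ) → ι → ℝ) (hg : Measurable g)
    (hdep : ∀ x y : ι → ℝ, (∀ i, ¬ p i → x i = y i) → g x = g y) :
    MeasurePreserving (fun (y : ι → ℝ) i => if p i then -y i + g y i else y i) := by
  set e := MeasurableEquiv.piEquivPiSubtypeProd (fun _ : ι => ℝ) (fun i => ¬ p i)
  have he : MeasurePreserving e :=
    volume_preserving_piEquivPiSubtypeProd (fun _ : ι => ℝ) (fun i => ¬ p i)
  let h : ({i // ¬ p i} → ℝ) → ({i // ¬ ¬ p i} → ℝ) := fun a i => g (e.symm (a, 0)) i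
  have hh : Measurable h := by
    refine measurable_pi_lambda _ fun i => ?_
    exact (measurable_pi_apply i.1).comp (hg.comp (e.symm.measurable.comp (by fun_prop)))
  -- With the unreflected coordinates fixed, the map is negation followed by a translation; Fubini
  -- assembles these fibres.
  have hskew : MeasurePreserving
      (fun q : ({i // ¬ p i} → ℝ) × ({i // ¬ ¬ p i} → ℝ) => (id q.1, -q.2 + h q.1))
      (volume.prod volume) (volume.prod volume) := by
    refine MeasurePreserving.skew_product (g := fun a z => -z + h a)
      (MeasurePreserving.id volume) ?_ ?_
    · exact measurable_snd.neg.add (hh.comp measurable_fst)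
    · refine Filter.Eventually.of_forall fun a => ?_
      exact ((measurePreserving_add_right volume (h a)).comp
        (Measure.measurePreserving_neg volume)).map_eq
  convert (he.symm.comp (hskew.comp he)) using 1
  funext y i
  have hy : g (e.symm ((e y).1, 0)) = g y := by
    refine hdep _ _ fun i hi => ?_
    simp [e, MeasurableEquiv.piEquivPiSubtypeProd, Equiv.piEquivPiSubtypeProd, hi]
  by_cases hi : p i
  · simp only [Function.comp_apply, id]
    simp [h, hy]
    simp [e, MeasurableEquiv.piEquivPiSubtypeProd, Equiv.piEquivPiSubtypeProd, hi]
  · simp [e, MeasurableEquiv.piEquivPiSubtypeProd, Equiv.piEquivPiSubtypeProd, hi]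

/-- The array with the entries of `w` at the indices satisfying `B` and of `y` elsewhere. -/
noncomputable def fillComplement {ι : Type*} (B : ι → Prop) [DecidablePred B]
    (w : EuclideanSpace ℝ ι) (y : EuclideanSpace ℝ {i // ¬ B i}) : EuclideanSpace ℝ ι :=
  WithLp.toLp 2 fun i => if h : B i then w i else y ⟨i, h⟩

/-- This identifies a slice with the Euclidean space of its free coordinates, where `μHE` is
Lebesgue measure. -/
theorem isometry_fillComplement {ι : Type*} [Fintype ι] (B : ι → Prop) [DecidablePred B]
    (w : EuclideanSpace ℝ ι) : Isometry (fillComplement B w) := by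
  refine Isometry.of_dist_eq fun x y => ?_
  rw [EuclideanSpace.dist_eq, EuclideanSpace.dist_eq]
  congr 1
  rw [← Fintype.sum_subtype_add_sum_subtype B]
  rw [Finset.sum_eq_zero (fun i _ => by simp [fillComplement, i.2]), zero_add]
  exact Finset.sum_congr rfl fun i _ => by simp [fillComplement, i.2]

theorem fillComplement_of_not {ι : Type*} {B : ι → Prop} [DecidablePred B]
    (w : EuclideanSpace ℝ ι) (y : EuclideanSpace ℝ {i // ¬ B i}) {i : ι} (h : ¬ B i) :
    fillComplement B w y i = y ⟨i, h⟩ := by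
  simp [fillComplement, h]

theorem fillComplement_of {ι : Type*} {B : ι → Prop} [DecidablePred B]
    (w : EuclideanSpace ℝ ι) (y : EuclideanSpace ℝ {i // ¬ B i}) {i : ι} (h : B i) :
    fillComplement B w y i = w i := by
  simp [fillComplement, h]

open MeasureTheory in
/-- If a coordinate reflection maps `S` into `S'`, and both sets lie in affine subspaces obtained
by fixing the coordinates satisfying `B`, then the volume of `S` is at most that of `S'`. -/
theorem euclideanHausdorffMeasure_le_of_coordReflection {ι : Type*} [Fintype ι]
    (B p : ι → Prop) [DecidablePred B] [DecidablePred p]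
    (g : EuclideanSpace ℝ ι → ι → ℝ) (hg : Continuous g)
    (hdep : ∀ x y : EuclideanSpace ℝ ι, (∀ i, ¬ p i → x i = y i) → g x = g y)
    (S S' : Set (EuclideanSpace ℝ ι))
    (hS : ∀ x ∈ S, ∀ y ∈ S, ∀ i, B i → x i = y i)
    (hS' : ∀ x ∈ S', ∀ y ∈ S', ∀ i, B i → x i = y i)
    (hmap : ∀ x ∈ S, WithLp.toLp 2 (fun i => if p i then -x i + g x i else x i) ∈ S') :
    μHE[Nat.card {i // ¬ B i}] S ≤ μHE[Nat.card {i // ¬ B i}] S' := by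
  rcases S.eq_empty_or_nonempty with rfl | ⟨w, hw⟩
  · simp
  set T : EuclideanSpace ℝ ι → EuclideanSpace ℝ ι :=
    fun x => WithLp.toLp 2 (fun i => if p i then -x i + g x i else x i) with hTdef
  let R : ({i // ¬ B i} → ℝ) → ({i // ¬ B i} → ℝ) := fun y i =>
    if p i then -y i + g (fillComplement B w (WithLp.toLp 2 y)) i else y i
  have hR : MeasurePreserving R := by
    refine measurePreserving_coordReflection (fun i : {i // ¬ B i} => p i)
      (fun y i => g (fillComplement B w (WithLp.toLp 2 y)) i) ?_ ?_
    · refine Continuous.measurable ?_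
      refine continuous_pi fun i => (continuous_apply i.1).comp (hg.comp ?_)
      exact (isometry_fillComplement B w).continuous.comp (PiLp.continuous_toLp 2 _)
    · intro x y hxy
      funext i
      refine congrFun (hdep _ _ fun j hj => ?_) i.1
      by_cases hB : B j
      · simp [fillComplement_of, hB]
      · simp only [fillComplement_of_not _ _ hB]
        exact hxy ⟨j, hB⟩ hj
  let R' : EuclideanSpace ℝ {i // ¬ B i} → EuclideanSpace ℝ {i // ¬ B i} :=
    fun y => WithLp.toLp 2 (R (WithLp.ofLp y))
  have hR' : MeasurePreserving R' :=
    (PiLp.volume_preserving_toLp _).comp (hR.comp (PiLp.volume_preserving_ofLp _))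
  have hvol : (μHE[Nat.card {i // ¬ B i}] : Measure (EuclideanSpace ℝ {i // ¬ B i})) = volume := by
    rw [← InnerProductSpace.euclideanHausdorffMeasure_eq_volume, finrank_euclideanSpace,
      Nat.card_eq_fintype_card]
  have hSub : S ⊆ fillComplement B w '' (fillComplement B w ⁻¹' S) := by
    intro x hx
    have hx' : fillComplement B w (WithLp.toLp 2 fun i => x i.1) = x := by
      ext i
      by_cases hB : B i
      · rw [fillComplement_of _ _ hB, hS w hw x hx i hB]
      · rw [fillComplement_of_not _ _ hB]
    exact ⟨WithLp.toLp 2 fun i => x i.1, by rw [Set.mem_preimage, hx']; exact hx, hx'⟩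
  -- The reflection may move coordinates in `B`, so the image lies in another slice, the one through
  -- `T w`.
  have hincl : fillComplement B w ⁻¹' S ⊆ R' ⁻¹' (fillComplement B (T w) ⁻¹' S') := by
    intro y hy
    have hmem := hmap _ hy
    have heq : fillComplement B (T w) (R' y) = T (fillComplement B w y) := by
      ext i
      by_cases hB : B i
      · rw [fillComplement_of _ _ hB]
        exact hS' _ (hmap w hw) _ hmem i hB
      · rw [fillComplement_of_not _ _ hB]
        simp [R', R, T, fillComplement_of_not _ _ hB]
    rw [Set.mem_preimage, Set.mem_preimage, heq]
    exact hmem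
  calc μHE[Nat.card {i // ¬ B i}] S
      ≤ μHE[Nat.card {i // ¬ B i}] (fillComplement B w '' (fillComplement B w ⁻¹' S)) :=
        measure_mono hSub
    _ = volume (fillComplement B w ⁻¹' S) := by
        rw [(isometry_fillComplement B w).euclideanHausdorffMeasure_image, hvol]
    _ ≤ volume (R' ⁻¹' (fillComplement B (T w) ⁻¹' S')) := measure_mono hincl
    -- This inequality holds for arbitrary sets, so `S'` need not be measurable.
    _ ≤ volume (fillComplement B (T w) ⁻¹' S') := by
        refine (Measure.le_map_apply hR'.measurable.aemeasurable _).trans_eq ?_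
        rw [hR'.map_eq]
    _ = μHE[Nat.card {i // ¬ B i}] (fillComplement B (T w) '' (fillComplement B (T w) ⁻¹' S')) := by
        rw [(isometry_fillComplement B (T w)).euclideanHausdorffMeasure_image, hvol]
    _ ≤ μHE[Nat.card {i // ¬ B i}] S' := measure_mono (Set.image_preimage_subset _ _)

/-! ### Interlacing rows of differences -/

/-- The lower bound for the `j`-th difference of a row imposed by the differences `a` (`α` of them)
of the row above and `c` (`γ` of them) of the row below. -/
noncomputable def diffLowerBound (a c : ℕ → ℝ) (α γ j : ℕ) : ℝ :=
  if j ≤ α then if j < γ then max (a j) (c (j + 1)) else a j else c (j + 1)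

/-- The upper bound for the `j`-th difference of a row imposed by the differences `a` of the row
above and `c` of the row below. -/
noncomputable def diffUpperBound (a c : ℕ → ℝ) (j : ℕ) : ℝ :=
  if j = 1 then c 1 else min (a (j - 1)) (c j)

/-- The numbers `α`, `β`, `γ` are the lengths of three consecutive rows of differences. -/
def ConsecutiveLengths (α β γ : ℕ) : Prop :=
  0 < β ∧ (α + 1 = β ∧ γ = β + 1 ∨ α = β ∧ γ = β)

-- The lower bound at `l` and the upper bound at `l + 1` are the max and min of the same pair `a l`,
-- `c (l + 1)`. Unpaired are `c 1` and the last lower bound, which is `c γ` for a trapezoid and `a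
-- α` for a parallelogram.
open Finset in
theorem sum_diffLowerBound_add_diffUpperBound (a c : ℕ → ℝ) {α β γ : ℕ}
    (h : ConsecutiveLengths α β γ) :
    ∑ l ∈ range β, (diffLowerBound a c α γ (l + 1) + diffUpperBound a c (l + 1)) =
      ∑ l ∈ range α, a (l + 1) + ∑ l ∈ range γ, c (l + 1) := by
  obtain ⟨hβ, h⟩ := h
  obtain ⟨t, rfl⟩ := Nat.exists_eq_add_one.mpr hβ
  have hlow : ∀ l ∈ range t, diffLowerBound a c α γ (l + 1) = max (a (l + 1)) (c (l + 2)) := by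
    intro l hl
    rw [mem_range] at hl
    rw [diffLowerBound, if_pos (by omega), if_pos (by omega)]
  have hupp : ∀ l ∈ range t, diffUpperBound a c (l + 1 + 1) = min (a (l + 1)) (c (l + 2)) := by
    intro l _
    simp [diffUpperBound]
  have hone : diffUpperBound a c (0 + 1) = c 1 := by simp [diffUpperBound]
  rw [sum_add_distrib, sum_range_succ, sum_range_succ' (fun l => diffUpperBound a c (l + 1)),
    sum_congr rfl hlow, sum_congr rfl hupp, hone]
  have hmm : ∑ l ∈ range t, max (a (l + 1)) (c (l + 2)) + ∑ l ∈ range t, min (a (l + 1)) (c (l + 2))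
      = ∑ l ∈ range t, a (l + 1) + ∑ l ∈ range t, c (l + 2) := by
    rw [← sum_add_distrib, ← sum_add_distrib]
    exact sum_congr rfl fun l _ => max_add_min _ _
  rcases h with ⟨h1, h2⟩ | ⟨h1, h2⟩
  · obtain rfl : α = t := by omega
    subst h2
    rw [diffLowerBound, if_neg (by omega), sum_range_succ _ (α + 1), sum_range_succ' _ α]
    linarith
  · subst h1 h2
    rw [diffLowerBound, if_pos le_rfl, if_neg (by omega), sum_range_succ _ t,
      sum_range_succ' (fun l => c (l + 1)) t]
    linarith

/-- The interlacing conditions on the differences `y` of a row with the rows above and below. -/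
def Interlaces (a y c : ℕ → ℝ) (α β γ : ℕ) : Prop :=
  (∀ j, 1 ≤ j → j ≤ β → (j ≤ α → a j ≤ y j) ∧ (j < β → y (j + 1) ≤ a j)) ∧
  (∀ j, 1 ≤ j → j ≤ γ → (j ≤ β → y j ≤ c j) ∧ (j < γ → c (j + 1) ≤ y j))

theorem interlaces_iff (a y c : ℕ → ℝ) {α β γ : ℕ} (h : ConsecutiveLengths α β γ) :
    Interlaces a y c α β γ ↔ ∀ j, 1 ≤ j → j ≤ β →
      diffLowerBound a c α γ j ≤ y j ∧ y j ≤ diffUpperBound a c j := by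
  obtain ⟨hβ, h⟩ := h
  constructor
  · rintro ⟨h1, h2⟩ j hj hjβ
    constructor
    · unfold diffLowerBound
      split_ifs with hα hγ
      · exact max_le ((h1 j hj hjβ).1 hα) ((h2 j hj hγ.le).2 hγ)
      · exact (h1 j hj hjβ).1 hα
      · exact (h2 j hj (by omega)).2 (by omega)
    · unfold diffUpperBound
      split_ifs with hone
      · subst hone
        exact (h2 1 hj (by omega)).1 hjβ
      · refine le_min ?_ ((h2 j hj (by omega)).1 hjβ)
        have := (h1 (j - 1) (by omega) (by omega)).2 (by omega)
        rwa [Nat.sub_add_cancel hj] at this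
  · intro H
    refine ⟨fun j hj hjβ => ⟨fun hα => ?_, fun hlt => ?_⟩,
      fun j hj hjγ => ⟨fun hβ' => ?_, fun hlt => ?_⟩⟩
    · refine le_trans ?_ (H j hj hjβ).1
      unfold diffLowerBound
      rw [if_pos hα]
      split_ifs
      · exact le_max_left _ _
      · exact le_rfl
    · refine (H (j + 1) (by omega) hlt).2.trans ?_
      rw [diffUpperBound, if_neg (by omega), Nat.add_sub_cancel]
      exact min_le_left _ _
    · refine (H j hj hβ').2.trans ?_
      unfold diffUpperBound
      split_ifs with hone
      · rw [hone]
      · exact min_le_right _ _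
    · refine le_trans ?_ (H j hj (by omega)).1
      unfold diffLowerBound
      rw [if_pos hlt]
      split_ifs
      · exact le_max_right _ _
      · exact le_rfl

theorem Interlaces.reflect {a y c : ℕ → ℝ} {α β γ : ℕ} (h : ConsecutiveLengths α β γ)
    (H : Interlaces a y c α β γ) {y' : ℕ → ℝ} (hy' : ∀ j, 1 ≤ j → j ≤ β →
      y' j = -y j + (diffLowerBound a c α γ j + diffUpperBound a c j)) :
    Interlaces a y' c α β γ := by
  rw [interlaces_iff _ _ _ h] at H ⊢
  intro j hj hjβ
  have := H j hj hjβ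
  rw [hy' j hj hjβ]
  constructor <;> linarith [this.1, this.2]

/-! ### Reflecting one row of an array -/

namespace ArraySpace

variable {n : ℕ} {b : ℕ → ℕ}

theorem entry_of_le (X : ArraySpace n b) {i j : ℕ} (hi : i ≤ n) (hj : j ≤ b i) :
    X.entry i j = X ⟨⟨i, Nat.lt_succ_of_le hi⟩, ⟨j, Nat.lt_succ_of_le hj⟩⟩ :=
  dif_pos ⟨Nat.lt_succ_of_le hi, Nat.lt_succ_of_le hj⟩

theorem entry_index (X : ArraySpace n b) (p : ArrayIndex n b) : X.entry p.1 p.2 = X p :=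
  dif_pos ⟨p.1.2, p.2.2⟩

theorem continuous_entry (i j : ℕ) : Continuous fun X : ArraySpace n b => X.entry i j := by
  unfold entry
  split_ifs <;> fun_prop

theorem continuous_rowDeriv (i j : ℕ) : Continuous fun X : ArraySpace n b => X.rowDeriv i j :=
  (continuous_entry i j).sub (continuous_entry i (j - 1))

theorem entry_eq_add_sum (X : ArraySpace n b) (i j : ℕ) :
    X.entry i j = X.entry i 0 + ∑ l ∈ Finset.range j, X.rowDeriv i (l + 1) := by
  simp only [rowDeriv, Nat.add_sub_cancel]
  rw [Finset.sum_range_sub]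
  ring

/-- Each inner row of a strip-concave array interlaces with the rows above and below it. -/
theorem IsStripConcave.interlaces {X : ArraySpace n b} (hX : X.IsStripConcave) {k : ℕ}
    (hk : k + 2 ≤ n) :
    Interlaces (X.rowDeriv k) (X.rowDeriv (k + 1)) (X.rowDeriv (k + 2))
      (b k) (b (k + 1)) (b (k + 2)) :=
  ⟨fun j hj hjb => hX (k + 1) j (by omega) (by omega) hj hjb,
    fun j hj hjb => hX (k + 2) j (by omega) hk hj hjb⟩

/-- Twice the centre of the reflection of the entry `x_{k+1,j}`. -/
noncomputable def reflectShift (k : ℕ) (X : ArraySpace n b) (j : ℕ) : ℝ :=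
  ∑ l ∈ Finset.range j,
    (diffLowerBound (X.rowDeriv k) (X.rowDeriv (k + 2)) (b k) (b (k + 2)) (l + 1) +
      diffUpperBound (X.rowDeriv k) (X.rowDeriv (k + 2)) (l + 1))

/-- The Bender–Knuth reflection: every difference of row `k + 1` is reflected in the interval
allowed by the rows `k` and `k + 2`. -/
noncomputable def reflectRow (k : ℕ) (X : ArraySpace n b) : ArraySpace n b :=
  WithLp.toLp 2 fun p =>
    if (p.1 : ℕ) = k + 1 then -X p + reflectShift k X p.2 else X p

theorem continuous_reflectShift (k j : ℕ) :
    Continuous fun X : ArraySpace n b => reflectShift k X j := by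
  have h1 := fun j => continuous_rowDeriv (n := n) (b := b) k j
  have h2 := fun j => continuous_rowDeriv (n := n) (b := b) (k + 2) j
  refine continuous_finsetSum _ fun l _ => Continuous.add ?_ ?_
  · unfold diffLowerBound
    split_ifs
    · exact (h1 _).max (h2 _)
    · exact h1 _
    · exact h2 _
  · unfold diffUpperBound
    split_ifs
    · exact h2 _
    · exact (h1 _).min (h2 _)

theorem entry_congr {X Y : ArraySpace n b} {i : ℕ}
    (h : ∀ p : ArrayIndex n b, (p.1 : ℕ) = i → X p = Y p) (j : ℕ) : X.entry i j = Y.entry i j := by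
  unfold entry
  split_ifs
  · exact h _ rfl
  · rfl

theorem reflectShift_congr {X Y : ArraySpace n b} {k : ℕ}
    (h : ∀ p : ArrayIndex n b, (p.1 : ℕ) ≠ k + 1 → X p = Y p) (j : ℕ) :
    reflectShift k X j = reflectShift k Y j := by
  have h1 : X.rowDeriv k = Y.rowDeriv k := by
    funext j
    simp only [rowDeriv, entry_congr (fun p hp => h p (by omega) : ∀ p : ArrayIndex n b,
      (p.1 : ℕ) = k → X p = Y p)]
  have h2 : X.rowDeriv (k + 2) = Y.rowDeriv (k + 2) := by
    funext j
    simp only [rowDeriv, entry_congr (fun p hp => h p (by omega) : ∀ p : ArrayIndex n b,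
      (p.1 : ℕ) = k + 2 → X p = Y p)]
  rw [reflectShift, reflectShift, h1, h2]

theorem entry_reflectRow_of_ne (X : ArraySpace n b) {i k : ℕ} (h : i ≠ k + 1) (j : ℕ) :
    (reflectRow k X).entry i j = X.entry i j :=
  entry_congr (fun p hp => by simp [reflectRow, hp, h]) j

theorem entry_reflectRow_self (X : ArraySpace n b) {k j : ℕ} (hk : k + 1 ≤ n)
    (hj : j ≤ b (k + 1)) :
    (reflectRow k X).entry (k + 1) j = -X.entry (k + 1) j + reflectShift k X j := by
  rw [entry_of_le _ hk hj, entry_of_le _ hk hj]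
  simp [reflectRow]

theorem rowDeriv_reflectRow_of_ne (X : ArraySpace n b) {i k : ℕ} (h : i ≠ k + 1) (j : ℕ) :
    (reflectRow k X).rowDeriv i j = X.rowDeriv i j := by
  simp only [rowDeriv, entry_reflectRow_of_ne X h]

theorem rowDeriv_reflectRow_self (X : ArraySpace n b) {k j : ℕ} (hk : k + 1 ≤ n)
    (hj : 1 ≤ j) (hjb : j ≤ b (k + 1)) :
    (reflectRow k X).rowDeriv (k + 1) j = -X.rowDeriv (k + 1) j +
      (diffLowerBound (X.rowDeriv k) (X.rowDeriv (k + 2)) (b k) (b (k + 2)) j +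
        diffUpperBound (X.rowDeriv k) (X.rowDeriv (k + 2)) j) := by
  obtain ⟨j, rfl⟩ := Nat.exists_eq_add_one.mpr hj
  rw [rowDeriv, rowDeriv, Nat.add_sub_cancel, entry_reflectRow_self X hk hjb,
    entry_reflectRow_self X hk (by omega), reflectShift, reflectShift, Finset.sum_range_succ]
  ring

theorem IsStripConcave.reflectRow {X : ArraySpace n b} (hX : X.IsStripConcave) {k : ℕ}
    (hk : k + 2 ≤ n) (hb : ConsecutiveLengths (b k) (b (k + 1)) (b (k + 2))) :
    (reflectRow k X).IsStripConcave := by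
  have H := (hX.interlaces hk).reflect hb
    (fun j hj hjb => rowDeriv_reflectRow_self X (by omega) hj hjb)
  intro i j hi hin hj hjb
  by_cases h1 : i = k + 1
  · subst h1
    simpa only [Nat.add_sub_cancel, rowDeriv_reflectRow_of_ne X (show k ≠ k + 1 by omega)]
      using H.1 j hj hjb
  by_cases h2 : i = k + 2
  · subst h2
    simpa only [show k + 2 - 1 = k + 1 by omega,
      rowDeriv_reflectRow_of_ne X (show k + 2 ≠ k + 1 by omega)] using H.2 j hj hjb
  · simpa only [rowDeriv_reflectRow_of_ne X h1,
      rowDeriv_reflectRow_of_ne X (show i - 1 ≠ k + 1 by omega)] using hX i j hi hin hj hjb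

theorem entry_zero_of_left_eq_zero {X : ArraySpace n b} (h0 : X.entry 0 0 = 0)
    (hl : X.left = 0) {i : ℕ} (hi : i ≤ n) : X.entry i 0 = 0 := by
  induction i with
  | zero => exact h0
  | succ i ih =>
    have := congrFun hl ⟨i, hi⟩
    simp only [left, Pi.zero_apply, ih (by omega)] at this
    simpa using this

theorem reflectShift_last {X : ArraySpace n b} (h0 : ∀ i ≤ n, X.entry i 0 = 0) {k : ℕ}
    (hk : k + 2 ≤ n) (hb : ConsecutiveLengths (b k) (b (k + 1)) (b (k + 2))) :
    reflectShift k X (b (k + 1)) = X.entry k (b k) + X.entry (k + 2) (b (k + 2)) := by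
  rw [reflectShift, sum_diffLowerBound_add_diffUpperBound _ _ hb, X.entry_eq_add_sum k,
    X.entry_eq_add_sum (k + 2), h0 k (by omega), h0 (k + 2) hk, zero_add, zero_add]

/-- Summing differences along the four sides recovers the boundary entries, so each polytope lies in
a single slice. -/
theorem eq_of_isBoundaryIndex {X Y : ArraySpace n b} (h0 : X.entry 0 0 = Y.entry 0 0)
    (hlow : X.lower = Y.lower) (hupp : X.upper = Y.upper) (hleft : X.left = Y.left)
    (hright : X.right = Y.right) (p : ArrayIndex n b) (hp : IsBoundaryIndex p) : X p = Y p := by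
  have hcol : ∀ i ≤ n, X.entry i 0 = Y.entry i 0 := by
    intro i
    induction i with
    | zero => exact fun _ => h0
    | succ i ih =>
      intro hi
      have := congrFun hleft ⟨i, hi⟩
      simp only [left, ih (by omega)] at this
      linarith
  have hrow : ∀ j ≤ b 0, X.entry 0 j = Y.entry 0 j := by
    intro j hj
    rw [X.entry_eq_add_sum, Y.entry_eq_add_sum, h0]
    congr 1
    refine Finset.sum_congr rfl fun l hl => ?_
    exact congrFun hupp ⟨l, (Finset.mem_range.mp hl).trans_le hj⟩
  have hlast : ∀ i ≤ n, X.entry i (b i) = Y.entry i (b i) := by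
    intro i
    induction i with
    | zero => exact fun _ => hrow _ le_rfl
    | succ i ih =>
      intro hi
      have := congrFun hright ⟨i, hi⟩
      simp only [right, ih (by omega)] at this
      linarith
  have key : ∀ i j : ℕ, i ≤ n → j ≤ b i → (i = 0 ∨ i = n ∨ j = 0 ∨ j = b i) →
      X.entry i j = Y.entry i j := by
    rintro i j hi hj (rfl | rfl | rfl | rfl)
    · exact hrow _ hj
    · rw [X.entry_eq_add_sum, Y.entry_eq_add_sum, hcol i le_rfl]
      congr 1
      refine Finset.sum_congr rfl fun l hl => ?_
      exact congrFun hlow ⟨l, (Finset.mem_range.mp hl).trans_le hj⟩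
    · exact hcol _ hi
    · exact hlast _ hi
  rw [← X.entry_index, ← Y.entry_index]
  exact key _ _ (Nat.le_of_lt_succ p.1.2) (Nat.le_of_lt_succ p.2.2) hp

end ArraySpace

/-! ### Action on the polytopes -/

section

open ArraySpace

variable {n : ℕ} {b : ℕ → ℕ}

theorem eq_of_mem_stripConcavePolytope {lam : Fin (b n) → ℝ} {lamBar : Fin (b 0) → ℝ}
    {mu nu : Fin n → ℝ} (X : ArraySpace n b) (hX : X ∈ stripConcavePolytope lam lamBar mu nu)
    (Y : ArraySpace n b) (hY : Y ∈ stripConcavePolytope lam lamBar mu nu)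
    (p : ArrayIndex n b) (hp : IsBoundaryIndex p) : X p = Y p := by
  obtain ⟨-, hX0, hX1, hX2, hX3, hX4⟩ := hX
  obtain ⟨-, hY0, hY1, hY2, hY3, hY4⟩ := hY
  exact eq_of_isBoundaryIndex (hX0.trans hY0.symm) (hX1.trans hY1.symm) (hX2.trans hY2.symm)
    (hX3.trans hY3.symm) (hX4.trans hY4.symm) p hp

/-- The reflection of row `k + 1` interchanges the `k`-th and `(k+1)`-st entries of `ν`. -/
theorem reflectRow_mem_stripConcavePolytope {lam : Fin (b n) → ℝ} {lamBar : Fin (b 0) → ℝ}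
    {nu : Fin n → ℝ} {k : ℕ} (hk : k + 2 ≤ n)
    (hb : ConsecutiveLengths (b k) (b (k + 1)) (b (k + 2))) {X : ArraySpace n b}
    (hX : X ∈ stripConcavePolytope lam lamBar 0 nu) :
    reflectRow k X ∈ stripConcavePolytope lam lamBar 0
      (nu ∘ Equiv.swap (⟨k, by omega⟩ : Fin n) ⟨k + 1, by omega⟩) := by
  obtain ⟨hsc, h00, hlow, hupp, hleft, hright⟩ := hX
  have hcol : ∀ i ≤ n, X.entry i 0 = 0 := fun i hi => entry_zero_of_left_eq_zero h00 hleft hi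
  have hcol' : ∀ i ≤ n, (reflectRow k X).entry i 0 = 0 := by
    intro i hi
    by_cases h : i = k + 1
    · subst h
      -- The shift vanishes at `j = 0`, so the first entry is negated; it survives only because μ =
      -- 0.
      rw [entry_reflectRow_self X hi (Nat.zero_le _), hcol _ hi]
      simp [reflectShift]
    · rw [entry_reflectRow_of_ne X h, hcol i hi]
  refine ⟨hsc.reflectRow hk hb, hcol' 0 (Nat.zero_le _), ?_, ?_, ?_, ?_⟩
  · rw [← hlow]
    funext j
    exact rowDeriv_reflectRow_of_ne X (by omega) _
  · rw [← hupp]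
    funext j
    exact rowDeriv_reflectRow_of_ne X (by omega) _
  · funext i
    simp only [left, Pi.zero_apply]
    rw [hcol' _ i.2, hcol' _ i.2.le, sub_zero]
  · subst hright
    have hself := entry_reflectRow_self X (by omega : k + 1 ≤ n) le_rfl
    rw [reflectShift_last hcol hk hb] at hself
    funext i
    simp only [right, Function.comp_apply]
    by_cases h1 : (i : ℕ) = k
    · rw [show i = ⟨k, by omega⟩ from Fin.ext h1, Equiv.swap_apply_left, hself, entry_reflectRow_of_ne X (by simp)]
      simp only
      ring
    by_cases h2 : (i : ℕ) = k + 1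
    · rw [show i = ⟨k + 1, by omega⟩ from Fin.ext h2, Equiv.swap_apply_right, hself, entry_reflectRow_of_ne X (by simp)]
      simp only
      ring
    · rw [Equiv.swap_apply_of_ne_of_ne (fun h => h1 (congrArg Fin.val h))
        (fun h => h2 (congrArg Fin.val h)), entry_reflectRow_of_ne X (by omega),
        entry_reflectRow_of_ne X (by omega)]

theorem measure_stripConcavePolytope_le_swap {lam : Fin (b n) → ℝ} {lamBar : Fin (b 0) → ℝ}
    (nu : Fin n → ℝ) {k : ℕ} (hk : k + 2 ≤ n)
    (hb : ConsecutiveLengths (b k) (b (k + 1)) (b (k + 2))) :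
    μHE[interiorCard n b] (stripConcavePolytope lam lamBar (0 : Fin n → ℝ) nu) ≤
      μHE[interiorCard n b] (stripConcavePolytope lam lamBar (0 : Fin n → ℝ)
        (nu ∘ Equiv.swap (⟨k, by omega⟩ : Fin n) ⟨k + 1, by omega⟩)) := by
  classical
  refine euclideanHausdorffMeasure_le_of_coordReflection IsBoundaryIndex
    (fun p : ArrayIndex n b => (p.1 : ℕ) = k + 1) (fun X p => reflectShift k X p.2)
    (continuous_pi fun p => continuous_reflectShift k p.2) (fun X Y h => ?_) _ _
    eq_of_mem_stripConcavePolytope eq_of_mem_stripConcavePolytope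
    (fun X hX => reflectRow_mem_stripConcavePolytope hk hb hX)
  funext p
  exact reflectShift_congr h p.2

theorem consecutiveLengths_of_configuration {m : ℕ}
    (hb : IsTrapezoid n m b ∨ IsParallelogram n m b) {k : ℕ} (hk : k + 2 ≤ n) :
    ConsecutiveLengths (b k) (b (k + 1)) (b (k + 2)) := by
  rcases hb with h | ⟨hm, h⟩ <;>
  · have h1 := h k (by omega)
    have h2 := h (k + 1) (by omega)
    have h3 := h (k + 2) hk
    unfold ConsecutiveLengths
    omega

end

theorem proposition1 (n m : ℕ) (hn : 0 < n) (b : ℕ → ℕ)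
    (hb : IsTrapezoid n m b ∨ IsParallelogram n m b)
    (lam : Fin (b n) → ℝ) (lamBar : Fin (b 0) → ℝ) (nu nu' : Fin n → ℝ)
    (hnu : ∃ σ : Equiv.Perm (Fin n), nu' = nu ∘ σ) :
    μHE[interiorCard n b] (stripConcavePolytope lam lamBar (0 : Fin n → ℝ) nu) =
      μHE[interiorCard n b] (stripConcavePolytope lam lamBar (0 : Fin n → ℝ) nu') := by
  obtain ⟨σ, rfl⟩ := hnu
  obtain ⟨n, rfl⟩ := Nat.exists_eq_add_one.mpr hn
  have hσ : σ ∈ Submonoid.closure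
      (Set.range fun i : Fin n => Equiv.swap i.castSucc i.succ) := by
    rw [Equiv.Perm.mclosure_swap_castSucc_succ]
    trivial
  induction hσ using Submonoid.closure_induction generalizing nu with
  | mem τ hτ =>
    obtain ⟨i, rfl⟩ := hτ
    have hk : (i : ℕ) + 2 ≤ n + 1 := by omega
    have hc := consecutiveLengths_of_configuration hb hk
    refine le_antisymm (measure_stripConcavePolytope_le_swap nu hk hc) ?_
    -- The same inequality for the swapped tuple gives the converse, as swapping twice restores ν.
    refine (measure_stripConcavePolytope_le_swap _ hk hc).trans_eq ?_
    congr 2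
    funext j
    exact congrArg nu (Equiv.swap_apply_self _ _ j)
  | one => rfl
  | mul τ ρ _ _ hτ hρ => exact (hτ nu).trans (hρ (nu ∘ τ))
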